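/- Let $G$ be a finite simple graph on $n$ vertices that contains exactly one cycle $C$, of length $m$ (for example a connected unicyclic graph; connectedness is not needed). Let $\Phi=(G,\varphi)$ be a complex unit gain graph on $G$: $\varphi$ assigns to every oriented edge $(u,v)$ of $G$ a complex number of modulus $1$, with $\varphi(v,u)=\varphi(u,v)^{-1}$. Let $A(\Phi)$ be the $V(G)\times V(G)$ matrix whose $(u,v)$ entry is $\varphi(u,v)$ if $u$ and $v$ are adjacent and $0$ otherwise, let $A(G)$ be the usual adjacency matrix of $G$, and put $P_\Phi(x)=\det(xI-A(\Phi))$ and $P_G(x)=\det(xI-A(G))$. Choose an orientation of $C$ and let $\varphi(C)$ be the product of the gains of the edges of $C$ taken in that orientation; let $\theta\in\mathbb{R}$ satisfy $\varphi(C)=e^{i\theta}$. Let $G-C$ be the graph obtained from $G$ by deleting all vertices of $C$, let $m_j(G-C)$ be the number of matchings of $G-C$ with exactly $j$ edges (so $m_0(G-C)=1$), and let $k$ be the matching number of $G-C$, that is, the largest number of edges in a matching of $G-C$. Then, as polynomials in $x$, $$P_\Phi(x)=P_G(x)+2(1-\cos\theta)\sum_{j=0}^{k}(-1)^j\,m_j(G-C)\,x^{\,n-m-2j}.$$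 -/

import Mathlib

open Polynomial

noncomputable section

namespace SimpleGraph

variable {V : Type*}

/-- A complex unit gain function on `G`: every oriented edge gets an element of the unit circle,
and the opposite orientation gets the inverse. -/
structure UnitGain (G : SimpleGraph V) where
  /-- The gain of an oriented edge. -/
  gain : G.Dart → Circle
  gain_symm : ∀ d : G.Dart, gain d.symm = (gain d)⁻¹

namespace UnitGain

variable {G : SimpleGraph V}

/-- The product of the gains of the successive oriented edges of a walk. For a closed walk that
runs once around a cycle this is the gain of that cycle, with the orientation of the walk. -/
def walkGain (φ : G.UnitGain) {u v : V} (w : G.Walk u v) : Circle :=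
  (w.darts.map φ.gain).prod

open Classical in
/-- The adjacency matrix of the gain graph `(G, φ)`. -/
def adjMatrix (φ : G.UnitGain) : Matrix V V ℂ :=
  Matrix.of fun i j => if h : G.Adj i j then (φ.gain ⟨(i, j), h⟩ : ℂ) else 0

end UnitGain

/-- A subgraph is a cycle if it consists of the vertices and edges of a closed walk of length at
least three without repeated vertices. -/
def Subgraph.IsCycleSubgraph {G : SimpleGraph V} (H : G.Subgraph) : Prop :=
  ∃ (u : V) (c : G.Walk u u), c.IsCycle ∧ c.toSubgraph = H

/-- The graph contains exactly one cycle. Connectedness is not imposed, so this covers the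
unicyclic graphs in the sense of connected graphs with exactly one cycle, and more. -/
def IsUnicyclic (G : SimpleGraph V) : Prop :=
  ∃! H : G.Subgraph, H.IsCycleSubgraph

/-- The number of matchings with exactly `i` edges. A subgraph satisfying `IsMatching` has no
isolated vertices, so it is the same as its set of edges. -/
def matchingCount (G : SimpleGraph V) (i : ℕ) : ℕ :=
  {M : G.Subgraph | M.IsMatching ∧ M.edgeSet.ncard = i}.ncard

/-- The matching number of a finite graph: the largest number of edges in a matching. -/
def matchingNumber (G : SimpleGraph V) : ℕ :=
  sSup {i : ℕ | ∃ M : G.Subgraph, M.IsMatching ∧ M.edgeSet.ncard = i}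

end SimpleGraph

end

namespace SimpleGraph

/-! Expand `det(xI - A)` by Leibniz. A permutation contributes only if it is admissible, that is, if
it moves each vertex along an edge or fixes it. An admissible involution contributes the same for
every gain: each swapped edge gives `W i j * W j i = 1`. So these terms cancel in `P_Φ - P_G`.

An admissible permutation that crosses a bridge swaps its ends
(`IsAdmissible.apply_apply_of_isBridge`). All edges off `C` are bridges, so a non-involutive one
runs once around `C`, in one of two directions, and permutes the rest
(`IsAdmissible.involutive_or_follows`). The terms of one direction sum to minus the product of
entries around `C`, times the characteristic polynomial of `G - C`
(`sum_sign_smul_prod_charmatrix_of_eqOn`). On `G - C` all admissible permutations are involutions,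
which correspond to matchings, so that factor is the matching polynomial. The two directions give
`-(e^{iθ} + e^{-iθ})` for `Φ` and `-2` for `G`, hence `2(1 - cos θ)`. -/

/-- A permutation that moves every vertex along an edge or not at all. -/
def IsAdmissible {V : Type*} (G : SimpleGraph V) (σ : Equiv.Perm V) : Prop :=
  ∀ v, σ v = v ∨ G.Adj v (σ v)

/-- A weighted adjacency matrix in which opposite orientations of an edge have inverse weights. -/
structure IsGainMatrix {V : Type*} (G : SimpleGraph V) (W : Matrix V V ℂ) : Prop where
  mul_eq_one : ∀ i j, G.Adj i j → W i j * W j i = 1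
  eq_zero : ∀ i j, ¬ G.Adj i j → W i j = 0

/-! ### Bridges, and matchings as admissible involutions -/

section

variable {V : Type*} {G : SimpleGraph V}

/-- A permutation along the edges that crosses a bridge swaps its two ends. -/
theorem IsAdmissible.apply_apply_of_isBridge [Finite V] {σ : Equiv.Perm V} (hσ : G.IsAdmissible σ)
    {a : V} (hb : G.IsBridge s(a, σ a)) : σ (σ a) = a := by
  classical
  have := Fintype.ofFinite V
  rw [isBridge_iff] at hb
  set H := G.deleteEdges {s(a, σ a)} with hH
  by_contra hne
  let S : Finset V := Finset.univ.filter fun v => H.Reachable a v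
  -- The component `S` of `a` without the bridge is closed under `σ⁻¹`: only a move from `σ a` to
  -- `a` could enter it from outside, which `hne` forbids. By finiteness `σ⁻¹` maps `S` onto itself,
  -- so `σ a` lies in `S`, against the bridge.
  have key : ∀ v, H.Reachable a (σ v) → H.Reachable a v := by
    intro v hv
    rcases hσ v with h | h
    · rwa [h] at hv
    · by_cases he : s(v, σ v) = s(a, σ a)
      · rw [Sym2.eq_iff] at he
        rcases he with ⟨h1, _⟩ | ⟨h1, h2⟩
        · rw [h1]
        · rw [h1] at h2; exact absurd h2 hne
      · have : H.Adj v (σ v) := by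
          rw [hH, deleteEdges_adj]; exact ⟨h, by simpa using he⟩
        exact hv.trans this.symm.reachable
  have hsub : S.map (σ⁻¹ : Equiv.Perm V).toEmbedding ⊆ S := by
    intro v hv
    rw [Finset.mem_map] at hv
    obtain ⟨w, hw, rfl⟩ := hv
    simp only [S, Finset.mem_filter, Finset.mem_univ, true_and] at hw ⊢
    apply key
    simpa using hw
  have heq := Finset.eq_of_subset_of_card_le hsub (by simp)
  have ha : a ∈ S := by simp [S]
  rw [← heq, Finset.mem_map] at ha
  obtain ⟨w, hw, hwa⟩ := ha
  have : w = σ a := by rw [← hwa]; simp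
  apply hb
  simpa [S, this] using hw

theorem Subgraph.IsMatching.ncard_verts [Finite V] {M : G.Subgraph} (hM : M.IsMatching) :
    M.verts.ncard = 2 * M.edgeSet.ncard := by
  classical
  have := Fintype.ofFinite V
  have := Fintype.ofFinite M.verts
  have := Fintype.ofFinite M.edgeSet
  rw [← Nat.card_coe_set_eq, ← Nat.card_coe_set_eq, Nat.card_eq_fintype_card,
    Nat.card_eq_fintype_card, ← Finset.card_univ, ← Finset.card_univ,
    Finset.card_eq_sum_card_fiberwise (f := hM.toEdge) (t := Finset.univ) (by simp),
    Finset.sum_const_nat (m := 2), mul_comm]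
  rintro ⟨e, he⟩ -
  induction e with | _ x y
  have h := hM.toEdge_preimage_singleton (u := x) (v := y) he
  have hne : x ≠ y := (M.adj_sub he).ne
  rw [← Finset.card_pair (a := (⟨x, M.edge_vert he⟩ : M.verts)) (b := ⟨y, Subgraph.Adj.snd_mem he⟩)
    (by simpa using hne)]
  congr 1
  ext v
  have := Set.ext_iff.1 h v
  simpa using this

/-- The edges swapped by a permutation, as a subgraph. -/
def swapSubgraph (G : SimpleGraph V) (σ : Equiv.Perm V) : G.Subgraph where
  verts := {v | G.Adj v (σ v) ∧ σ (σ v) = v}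
  Adj v w := G.Adj v w ∧ σ v = w ∧ σ w = v
  adj_sub h := h.1
  edge_vert := by rintro v w ⟨h, rfl, h'⟩; exact ⟨h, h'⟩
  symm := ⟨fun v w ⟨h, h1, h2⟩ => ⟨h.symm, h2, h1⟩⟩

theorem isMatching_swapSubgraph (σ : Equiv.Perm V) : (G.swapSubgraph σ).IsMatching := by
  rintro v ⟨h1, h2⟩
  exact ⟨σ v, ⟨h1, rfl, h2⟩, fun w hw => hw.2.1.symm⟩

theorem IsAdmissible.verts_swapSubgraph [Fintype V] [DecidableEq V] {σ : Equiv.Perm V}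
    (hσ : G.IsAdmissible σ) (h2 : ∀ v, σ (σ v) = v) :
    (G.swapSubgraph σ).verts = (σ.support : Set V) := by
  ext v
  simp only [swapSubgraph, Set.mem_ofPred_eq, Finset.mem_coe, Equiv.Perm.mem_support, h2, and_true]
  exact ⟨fun h => h.ne', fun h => (hσ v).resolve_left h⟩

theorem IsAdmissible.card_support [Fintype V] [DecidableEq V] {σ : Equiv.Perm V}
    (hσ : G.IsAdmissible σ) (h2 : ∀ v, σ (σ v) = v) :
    σ.support.card = 2 * (G.swapSubgraph σ).edgeSet.ncard := by
  rw [← (isMatching_swapSubgraph σ).ncard_verts, hσ.verts_swapSubgraph h2, Set.ncard_coe_finset]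

open Classical in
theorem Subgraph.IsMatching.exists_swapSubgraph_eq {M : G.Subgraph} (hM : M.IsMatching) :
    ∃ σ : Equiv.Perm V, G.IsAdmissible σ ∧ (∀ v, σ (σ v) = v) ∧ G.swapSubgraph σ = M := by
  choose! f hf using fun v (hv : v ∈ M.verts) => (hM hv).exists
  let g : V → V := fun v => if v ∈ M.verts then f v else v
  have hg : ∀ v, v ∈ M.verts → M.Adj v (g v) := fun v hv => by simpa [g, hv] using hf v hv
  have hg' : ∀ v, v ∉ M.verts → g v = v := fun v hv => by simp [g, hv]
  have hinv : Function.Involutive g := by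
    intro v
    by_cases hv : v ∈ M.verts
    · have h1 := hg v hv
      exact hM.eq_of_adj_left (hg _ (M.edge_vert h1.symm)) h1.symm
    · rw [hg' v hv, hg' v hv]
  refine ⟨hinv.toPerm, fun v => ?_, hinv, ?_⟩
  · by_cases hv : v ∈ M.verts
    · exact Or.inr (M.adj_sub (hg v hv))
    · exact Or.inl (hg' v hv)
  · have hadj : ∀ v w, G.Adj v w ∧ g v = w ∧ g w = v ↔ M.Adj v w := by
      intro v w
      constructor
      · rintro ⟨h, rfl, h2⟩
        by_contra hn
        have hv : v ∉ M.verts := fun hv => hn (hg v hv)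
        exact h.ne (hg' v hv).symm
      · intro h
        have h1 : g v = w := hM.eq_of_adj_left (hg v (M.edge_vert h)) h
        exact ⟨M.adj_sub h, h1, h1 ▸ hinv v⟩
    ext v w
    · change G.Adj v (g v) ∧ g (g v) = v ↔ _
      constructor
      · rintro ⟨h, h2⟩
        exact M.edge_vert ((hadj v (g v)).1 ⟨h, rfl, h2⟩)
      · intro hv
        exact ⟨M.adj_sub (hg v hv), hinv v⟩
    · exact hadj v w

theorem IsAdmissible.swapSubgraph_injective {σ τ : Equiv.Perm V}
    (hσ : G.IsAdmissible σ) (hσ2 : ∀ v, σ (σ v) = v) (hτ : G.IsAdmissible τ)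
    (hτ2 : ∀ v, τ (τ v) = v) (h : G.swapSubgraph σ = G.swapSubgraph τ) : σ = τ := by
  have aux : ∀ {σ τ : Equiv.Perm V}, G.IsAdmissible σ → (∀ v, σ (σ v) = v) →
      G.swapSubgraph σ = G.swapSubgraph τ → ∀ v, σ v ≠ v → τ v = σ v := by
    intro σ τ hσ hσ2 h v hv
    have : (G.swapSubgraph σ).Adj v (σ v) := ⟨(hσ v).resolve_left hv, rfl, hσ2 v⟩
    rw [h] at this
    exact this.2.1
  ext v
  by_cases h1 : σ v = v
  · by_cases h2 : τ v = v
    · rw [h1, h2]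
    · exact aux hτ hτ2 h.symm v h2
  · exact (aux hσ hσ2 h v h1).symm

/-- Swapping the ends of every matching edge turns matchings into admissible involutions,
bijectively; this is the form in which they occur in the Leibniz sum. -/
theorem matchingCount_eq [Fintype V] [DecidableEq V] (i : ℕ) : G.matchingCount i =
    {σ : Equiv.Perm V | G.IsAdmissible σ ∧ (∀ v, σ (σ v) = v) ∧ σ.support.card = 2 * i}.ncard := by
  rw [matchingCount]
  symm
  refine Set.ncard_congr (fun σ _ => G.swapSubgraph σ) ?_ ?_ ?_
  · rintro σ ⟨h1, h2, h3⟩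
    refine ⟨isMatching_swapSubgraph σ, ?_⟩
    have := h1.card_support h2
    omega
  · rintro σ τ ⟨h1, h2, -⟩ ⟨h3, h4, -⟩ h
    exact h1.swapSubgraph_injective h2 h3 h4 h
  · rintro M ⟨hM, hi⟩
    obtain ⟨σ, h1, h2, rfl⟩ := hM.exists_swapSubgraph_eq
    exact ⟨σ, ⟨h1, h2, by rw [h1.card_support h2, hi]⟩, rfl⟩

theorem Subgraph.IsMatching.ncard_edgeSet_le [Finite V] {M : G.Subgraph} (hM : M.IsMatching) :
    M.edgeSet.ncard ≤ G.matchingNumber := by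
  -- Boundedness is needed because `sSup` of an unbounded set of naturals is `0`.
  refine le_csSup ⟨Nat.card V, ?_⟩ ⟨M, hM, rfl⟩
  rintro _ ⟨M, hM, rfl⟩
  have h1 := hM.ncard_verts
  have h2 : M.verts.ncard ≤ Nat.card V := Set.ncard_le_card _
  omega

/-! ### Leibniz terms of involutions and the matching polynomial -/

variable [Fintype V] [DecidableEq V] {W : Matrix V V ℂ}

theorem IsGainMatrix.prod_charmatrix_eq_zero (hW : G.IsGainMatrix W) {σ : Equiv.Perm V}
    (hσ : ¬ G.IsAdmissible σ) : ∏ v, W.charmatrix (σ v) v = 0 := by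
  simp only [IsAdmissible, not_forall, not_or] at hσ
  obtain ⟨v, h1, h2⟩ := hσ
  apply Finset.prod_eq_zero (Finset.mem_univ v)
  rw [Matrix.charmatrix_apply_ne _ _ _ h1, hW.eq_zero _ _ fun h => h2 h.symm]
  simp

/-- Swapped pairs multiply to `1` and fixed vertices give `X`, so the gains disappear. -/
theorem IsGainMatrix.prod_charmatrix_of_involutive (hW : G.IsGainMatrix W) {σ : Equiv.Perm V}
    (hσ : G.IsAdmissible σ) (h2 : ∀ v, σ (σ v) = v) :
    ∏ v, W.charmatrix (σ v) v = X ^ (Fintype.card V - σ.support.card) := by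
  have h1 : ∏ v ∈ σ.support, W.charmatrix (σ v) v = 1 := by
    refine Finset.prod_involution (fun v _ => σ v) ?_ ?_ ?_ ?_
    · intro v hv
      rw [Equiv.Perm.mem_support] at hv
      rw [h2, Matrix.charmatrix_apply_ne _ _ _ hv, Matrix.charmatrix_apply_ne _ _ _ hv.symm,
        neg_mul_neg, ← C_mul, hW.mul_eq_one _ _ ((hσ v).resolve_left hv).symm, C_1]
    · intro v hv _
      exact Equiv.Perm.mem_support.1 hv
    · intro v hv
      exact Equiv.Perm.apply_mem_support.2 hv
    · intro v hv
      exact h2 v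
  rw [← Finset.prod_mul_prod_compl σ.support, h1, one_mul, Finset.prod_congr rfl (g := fun _ => X),
    Finset.prod_const, Finset.card_compl]
  intro v hv
  have hv' : σ v = v := by simpa using hv
  rw [hv', Matrix.charmatrix_apply_eq, hW.eq_zero _ _ G.irrefl, C_0, sub_zero]

theorem sign_of_involutive {σ : Equiv.Perm V} (h2 : ∀ v, σ (σ v) = v) :
    Equiv.Perm.sign σ = (-1) ^ (σ.support.card / 2) := by
  have h : σ ^ 2 = 1 := by ext v; simp [pow_two, h2]
  rw [Equiv.Perm.sign_of_pow_two_eq_one h, Equiv.Perm.card_fixedPoints,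
    Equiv.Perm.sum_cycleType, Nat.sub_sub_self (Finset.card_le_univ _)]

/-- The matching polynomial formula for graphs without permutations along cycles. -/
theorem IsGainMatrix.charpoly_eq_of_involutive (hW : G.IsGainMatrix W)
    (h : ∀ σ, G.IsAdmissible σ → ∀ v, σ (σ v) = v) :
    W.charpoly = ∑ i ∈ Finset.range (G.matchingNumber + 1),
      (-1) ^ i * (G.matchingCount i : ℂ[X]) * X ^ (Fintype.card V - 2 * i) := by
  classical
  rw [Matrix.charpoly, Matrix.det_apply,
    ← Finset.sum_filter_of_ne (p := G.IsAdmissible)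
      (fun σ _ hne => by_contra fun hn => hne (by rw [hW.prod_charmatrix_eq_zero hn, smul_zero])),
    ← Finset.sum_fiberwise_of_maps_to (g := fun σ => σ.support.card / 2)
      (t := Finset.range (G.matchingNumber + 1))]
  · refine Finset.sum_congr rfl fun i _ => ?_
    rw [Finset.sum_congr rfl (g := fun _ => (-1) ^ i * X ^ (Fintype.card V - 2 * i)),
      Finset.sum_const, matchingCount_eq, nsmul_eq_mul]
    · rw [← Set.ncard_coe_finset]
      have : ((((Finset.univ.filter G.IsAdmissible).filter fun σ => σ.support.card / 2 = i) :
          Finset (Equiv.Perm V)) : Set (Equiv.Perm V)) =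
          {σ | G.IsAdmissible σ ∧ (∀ v, σ (σ v) = v) ∧ σ.support.card = 2 * i} := by
        ext σ
        simp only [Finset.coe_filter, Finset.mem_filter, Finset.mem_univ, true_and,
          Set.mem_ofPred_eq]
        constructor
        · rintro ⟨h1, h3⟩
          have := h1.card_support (h σ h1)
          exact ⟨h1, h σ h1, by omega⟩
        · rintro ⟨h1, _, h3⟩
          exact ⟨h1, by omega⟩
      rw [this]
      ring
    · intro σ hσ
      simp only [Finset.mem_filter, Finset.mem_univ, true_and] at hσ
      obtain ⟨h1, h3⟩ := hσ
      have h4 := h1.card_support (h σ h1)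
      have h5 : σ.support.card = 2 * i := by omega
      rw [hW.prod_charmatrix_of_involutive h1 (h σ h1), sign_of_involutive (h σ h1), h5,
        Nat.mul_div_cancel_left _ two_pos]
      simp [Units.smul_def]
  · intro σ hσ
    have hσ : G.IsAdmissible σ := by simpa using hσ
    have h4 := hσ.card_support (h σ hσ)
    have h5 := (G.isMatching_swapSubgraph σ).ncard_edgeSet_le
    simp only [Finset.mem_range]
    omega

end

end SimpleGraph

namespace SimpleGraph

/-! ### Permutations running along the cycle -/

section

variable {V : Type*} {G : SimpleGraph V}

/-- A permutation that follows a cyclic permutation once and can never turn back follows it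
everywhere. -/
theorem apply_eq_of_isCycle_of_follows [Finite V] {ρ σ : Equiv.Perm V} (hρ : ρ.IsCycle)
    (step : ∀ w, σ (σ w) ≠ w → ρ w = σ w ∨ ρ (σ w) = w) {v : V} (hv : σ (σ v) ≠ v)
    (h : ρ v = σ v) {w : V} (hw : ρ w ≠ w) : σ w = ρ w := by
  -- Induction along the `ρ`-orbit of `v`. Following `ρ` backwards after a forward step would make
  -- `σ` return at once, so the direction persists.
  have hpow : ∀ n : ℕ, σ (σ ((ρ ^ n) v)) ≠ (ρ ^ n) v ∧ ρ ((ρ ^ n) v) = σ ((ρ ^ n) v) := by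
    intro n
    induction n with
    | zero => exact ⟨hv, h⟩
    | succ n ih =>
      obtain ⟨h1, h2⟩ := ih
      rw [pow_succ', Equiv.Perm.mul_apply, h2]
      have h3 : σ (σ (σ ((ρ ^ n) v))) ≠ σ ((ρ ^ n) v) := fun h => h1 (σ.injective h)
      refine ⟨h3, (step _ h3).resolve_right fun h4 => h1 ?_⟩
      rw [← h2] at h4 ⊢
      exact ρ.injective h4
  have hρv : ρ v ≠ v := by
    intro h'
    rw [h] at h'
    exact hv (by rw [h', h'])
  obtain ⟨n, rfl⟩ := hρ.exists_pow_eq hρv hw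
  exact (hpow n).2.symm

/-- If all edges off the cycle `ρ` are bridges, then an admissible permutation is an involution
or runs along the cycle in one of its two directions. -/
theorem IsAdmissible.involutive_or_follows [Finite V] {ρ σ : Equiv.Perm V} (hρ : ρ.IsCycle)
    (hedge : ∀ a b, G.Adj a b → ¬ (ρ a = b ∨ ρ b = a) → G.IsBridge s(a, b))
    (hσ : G.IsAdmissible σ) :
    (∀ v, σ (σ v) = v) ∨ (∀ v, ρ v ≠ v → σ v = ρ v) ∨ (∀ v, ρ v ≠ v → σ v = ρ⁻¹ v) := by
  by_cases h : ∀ v, σ (σ v) = v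
  · exact Or.inl h
  push Not at h
  obtain ⟨v, hv⟩ := h
  have step : ∀ w, σ (σ w) ≠ w → ρ w = σ w ∨ ρ (σ w) = w := by
    intro w hw
    by_contra hn
    have hadj : G.Adj w (σ w) := (hσ w).resolve_left fun h => hw (by rw [h, h])
    exact hw (hσ.apply_apply_of_isBridge (hedge _ _ hadj hn))
  right
  rcases step v hv with h1 | h1
  · exact Or.inl fun w hw => apply_eq_of_isCycle_of_follows hρ step hv h1 hw
  · right
    intro w hw
    -- The hypothesis `step` is symmetric under `ρ ↔ ρ⁻¹`, which covers the opposite direction.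
    refine apply_eq_of_isCycle_of_follows hρ.inv (fun w hw => ?_) hv
      (by rw [Equiv.Perm.inv_eq_iff_eq, h1]) fun h => hw (Equiv.Perm.inv_eq_iff_eq.1 h).symm
    rw [Equiv.Perm.inv_eq_iff_eq, Equiv.Perm.inv_eq_iff_eq, eq_comm, @eq_comm _ (σ w)]
    exact (step w hw).symm

/-- Extended by the identity, `τ` is admissible on `G`, and any edge joining two fixed points of `ρ`
is a bridge. This replaces the statement that `G - C` is a forest. -/
theorem IsAdmissible.apply_apply_of_induce_fixedPoints [Finite V] {ρ : Equiv.Perm V} {s : Set V}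
    (hs : ∀ v, v ∈ s ↔ ρ v = v)
    (hedge : ∀ a b, G.Adj a b → ¬ (ρ a = b ∨ ρ b = a) → G.IsBridge s(a, b))
    {τ : Equiv.Perm s} (hτ : (G.induce s).IsAdmissible τ) (v : s) : τ (τ v) = v := by
  classical
  have happ : ∀ v : s, Equiv.Perm.ofSubtype τ (v : V) = τ v := fun v =>
    Equiv.Perm.ofSubtype_apply_coe τ v
  have hσ : G.IsAdmissible (Equiv.Perm.ofSubtype τ) := by
    intro v
    by_cases hv : v ∈ s
    · rw [happ ⟨v, hv⟩]
      rcases hτ ⟨v, hv⟩ with h | h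
      · exact Or.inl (by rw [h])
      · exact Or.inr h
    · exact Or.inl (Equiv.Perm.ofSubtype_apply_of_not_mem τ hv)
  rcases hτ v with h | h
  · rw [h, h]
  · have hne : (v : V) ≠ τ v := G.ne_of_adj h
    have hb := hedge v (τ v) h (by
      rw [(hs _).1 v.2, (hs _).1 (τ v).2]
      rintro (h | h)
      · exact hne h
      · exact hne h.symm)
    rw [← happ v] at hb
    have := hσ.apply_apply_of_isBridge hb
    rw [happ, happ] at this
    exact Subtype.ext this

theorem IsGainMatrix.induce {W : Matrix V V ℂ} (hW : G.IsGainMatrix W) (s : Set V) :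
    (G.induce s).IsGainMatrix (W.submatrix ((↑) : s → V) (↑)) :=
  ⟨fun i j h => hW.mul_eq_one i j h, fun i j h => hW.eq_zero i j h⟩

variable [Fintype V] [DecidableEq V]

/-- The part of the Leibniz expansion of a characteristic polynomial that belongs to the
permutations agreeing with a given one off its fixed points. -/
theorem sum_sign_smul_prod_charmatrix_of_eqOn (W : Matrix V V ℂ) (ρ : Equiv.Perm V) {s : Set V}
    [Fintype s] [DecidablePred (· ∈ s)] (hs : ∀ v, v ∈ s ↔ ρ v = v) :
    ∑ σ : Equiv.Perm V with ∀ v, ρ v ≠ v → σ v = ρ v,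
        Equiv.Perm.sign σ • ∏ v, W.charmatrix (σ v) v =
      (Equiv.Perm.sign ρ • ∏ v ∈ ρ.support, W.charmatrix (ρ v) v) *
        (W.submatrix ((↑) : s → V) (↑)).charpoly := by
  rw [Matrix.charpoly, Matrix.det_apply, Finset.mul_sum]
  symm
  have happ : ∀ (τ : Equiv.Perm s) (v : s), Equiv.Perm.ofSubtype τ (v : V) = τ v := fun τ v =>
    Equiv.Perm.ofSubtype_apply_coe τ v
  have hout : ∀ (τ : Equiv.Perm s) v, ρ v ≠ v → Equiv.Perm.ofSubtype τ v = v := fun τ v hv =>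
    Equiv.Perm.ofSubtype_apply_of_not_mem τ (fun h => hv ((hs v).1 h))
  -- Such permutations are exactly `ρ` times a permutation of its fixed points; sign and product
  -- then factor.
  refine Finset.sum_bij (fun τ _ => ρ * Equiv.Perm.ofSubtype τ) ?_ ?_ ?_ ?_
  · intro τ _
    rw [Finset.mem_filter]
    exact ⟨Finset.mem_univ _, fun v hv => by rw [Equiv.Perm.mul_apply, hout τ v hv]⟩
  · intro τ _ τ' _ h
    exact Equiv.Perm.ofSubtype_injective (mul_left_cancel h)
  · intro σ hσ
    rw [Finset.mem_filter] at hσ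
    have : ρ⁻¹ * σ ∈ (Equiv.Perm.ofSubtype : Equiv.Perm s →* Equiv.Perm V).range := by
      rw [Equiv.Perm.mem_range_ofSubtype_iff]
      intro v hv
      rw [Finset.mem_coe, Equiv.Perm.mem_support] at hv
      change v ∈ s
      rw [hs]
      by_contra h
      apply hv
      rw [Equiv.Perm.mul_apply, hσ.2 v h, ← Equiv.Perm.mul_apply, inv_mul_cancel, Equiv.Perm.one_apply]
    obtain ⟨τ, hτ⟩ := this
    exact ⟨τ, Finset.mem_univ _, by rw [hτ, mul_inv_cancel_left]⟩
  · intro τ _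
    have h1 : ∏ v ∈ ρ.support, W.charmatrix ((ρ * Equiv.Perm.ofSubtype τ) v) v =
        ∏ v ∈ ρ.support, W.charmatrix (ρ v) v :=
      Finset.prod_congr rfl fun v hv => by
        rw [Equiv.Perm.mul_apply, hout τ v (Equiv.Perm.mem_support.1 hv)]
    have h2 : ∏ v ∈ ρ.supportᶜ, W.charmatrix ((ρ * Equiv.Perm.ofSubtype τ) v) v =
        ∏ v : s, (W.submatrix ((↑) : s → V) (↑)).charmatrix (τ v) v := by
      rw [Finset.prod_subtype (p := (· ∈ s)) _ (fun v => by simp [hs])]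
      refine Finset.prod_congr rfl fun v _ => ?_
      rw [Equiv.Perm.mul_apply, happ, (hs _).1 (τ v).2]
      simp [Matrix.charmatrix_apply, Matrix.diagonal_apply, Subtype.ext_iff]
    rw [Equiv.Perm.sign_mul, Equiv.Perm.sign_ofSubtype, ← Finset.prod_mul_prod_compl ρ.support,
      h1, h2, smul_mul_smul_comm]

/-- A cycle of length `m` has sign `-(-1)^m`, and its `m` off-diagonal entries contribute another
`(-1)^m`; parity drops out. -/
theorem sign_smul_prod_charmatrix_of_isCycle (W : Matrix V V ℂ) {ρ : Equiv.Perm V}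
    (hρ : ρ.IsCycle) :
    Equiv.Perm.sign ρ • ∏ v ∈ ρ.support, W.charmatrix (ρ v) v =
      -C (∏ v ∈ ρ.support, W (ρ v) v) := by
  rw [Finset.prod_congr rfl (g := fun v => -1 * C (W (ρ v) v)), Finset.prod_mul_distrib,
    Finset.prod_const, hρ.sign, map_prod]
  · rcases neg_one_pow_eq_or ℂ[X] ρ.support.card with h | h <;>
      simp [Units.smul_def, ← mul_assoc, ← mul_pow]
  · intro v hv
    rw [Matrix.charmatrix_apply_ne _ _ _ (Equiv.Perm.mem_support.1 hv), neg_one_mul]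

/-- Only the families following `ρ` and `ρ⁻¹` survive in the difference; `h3` makes them disjoint.
Each carries a minus sign, hence `W'` before `W` in the factor. -/
theorem IsGainMatrix.charpoly_sub_charpoly {W W' : Matrix V V ℂ} (hW : G.IsGainMatrix W)
    (hW' : G.IsGainMatrix W') {ρ : Equiv.Perm V} (hρ : ρ.IsCycle)
    (h3 : ∀ v, ρ v ≠ v → ρ (ρ v) ≠ v)
    (hedge : ∀ a b, G.Adj a b → ¬ (ρ a = b ∨ ρ b = a) → G.IsBridge s(a, b))
    {s : Set V} [Fintype s] (hs : ∀ v, v ∈ s ↔ ρ v = v) :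
    W.charpoly - W'.charpoly =
      C (∏ v ∈ ρ.support, W' (ρ v) v + ∏ v ∈ ρ.support, W' v (ρ v) -
        ∏ v ∈ ρ.support, W (ρ v) v - ∏ v ∈ ρ.support, W v (ρ v)) *
      ∑ i ∈ Finset.range ((G.induce s).matchingNumber + 1),
        (-1) ^ i * ((G.induce s).matchingCount i : ℂ[X]) * X ^ (Fintype.card s - 2 * i) := by
  classical
  have hinv : ∀ U : Matrix V V ℂ,
      ∏ v ∈ ρ⁻¹.support, U (ρ⁻¹ v) v = ∏ v ∈ ρ.support, U v (ρ v) := by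
    intro U
    rw [Equiv.Perm.support_inv]
    refine Finset.prod_bij (fun v _ => ρ⁻¹ v) ?_ ?_ ?_ ?_
    · intro v hv
      rw [← Equiv.Perm.support_inv] at hv ⊢
      exact Equiv.Perm.apply_mem_support.2 hv
    · intro v _ w _ h
      exact ρ⁻¹.injective h
    · intro v hv
      exact ⟨ρ v, Equiv.Perm.apply_mem_support.2 hv, by simp⟩
    · intro v _
      simp
  have hQ : ∀ U : Matrix V V ℂ, G.IsGainMatrix U →
      (U.submatrix ((↑) : s → V) (↑)).charpoly = _ := fun U hU =>
    (hU.induce s).charpoly_eq_of_involutive fun τ hτ v =>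
      hτ.apply_apply_of_induce_fixedPoints hs hedge v
  have hs' : ∀ v, v ∈ s ↔ ρ⁻¹ v = v := fun v => by
    rw [hs, Equiv.Perm.inv_eq_iff_eq, eq_comm]
  have hne' : ∀ v, ρ⁻¹ v ≠ v ↔ ρ v ≠ v := fun v => by rw [Ne, ← hs', hs]
  let R : Equiv.Perm V → Finset (Equiv.Perm V) := fun ρ =>
    Finset.univ.filter fun σ => ∀ v, ρ v ≠ v → σ v = ρ v
  have hR : ∀ (U : Matrix V V ℂ), G.IsGainMatrix U →
      ∑ σ ∈ R ρ, Equiv.Perm.sign σ • ∏ v, U.charmatrix (σ v) v +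
      ∑ σ ∈ R ρ⁻¹, Equiv.Perm.sign σ • ∏ v, U.charmatrix (σ v) v = _ := fun U hU => by
    rw [sum_sign_smul_prod_charmatrix_of_eqOn U ρ hs,
      sum_sign_smul_prod_charmatrix_of_eqOn U ρ⁻¹ hs', sign_smul_prod_charmatrix_of_isCycle U hρ,
      sign_smul_prod_charmatrix_of_isCycle U hρ.inv, hinv, hQ U hU, ← add_mul]
  have hdisj : Disjoint (R ρ) (R ρ⁻¹) := by
    rw [Finset.disjoint_left]
    intro σ h1 h2
    simp only [R, Finset.mem_filter, Finset.mem_univ, true_and] at h1 h2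
    obtain ⟨v, hv, -⟩ := hρ
    have h4 := h1 v hv
    rw [h2 v ((hne' v).2 hv), Equiv.Perm.inv_eq_iff_eq] at h4
    exact h3 v hv h4.symm
  have hdiff : W.charpoly - W'.charpoly = ∑ σ ∈ R ρ ∪ R ρ⁻¹,
      (Equiv.Perm.sign σ • ∏ v, W.charmatrix (σ v) v -
        Equiv.Perm.sign σ • ∏ v, W'.charmatrix (σ v) v) := by
    rw [Matrix.charpoly, Matrix.charpoly, Matrix.det_apply, Matrix.det_apply,
      ← Finset.sum_sub_distrib]
    symm
    refine Finset.sum_subset (Finset.subset_univ _) fun σ _ hσ => ?_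
    rw [← smul_sub]
    simp only [R, Finset.mem_union, Finset.mem_filter, Finset.mem_univ, true_and, not_or] at hσ
    by_cases hadm : G.IsAdmissible σ
    · rcases hadm.involutive_or_follows hρ hedge with h | h | h
      · rw [hW.prod_charmatrix_of_involutive hadm h, hW'.prod_charmatrix_of_involutive hadm h,
          sub_self, smul_zero]
      · exact absurd h hσ.1
      · exact absurd (fun v hv => h v ((hne' v).1 hv)) hσ.2
    · rw [hW.prod_charmatrix_eq_zero hadm, hW'.prod_charmatrix_eq_zero hadm, sub_self, smul_zero]
  rw [hdiff, Finset.sum_sub_distrib, Finset.sum_union hdisj, Finset.sum_union hdisj, hR W hW,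
    hR W' hW', ← sub_mul]
  congr 1
  simp only [C_add, C_sub]
  ring

end

/-! ### The unique cycle, its rotation and its gain -/

section

variable {V : Type*} {G : SimpleGraph V}

theorem UnitGain.isGainMatrix_adjMatrix (φ : G.UnitGain) : G.IsGainMatrix φ.adjMatrix where
  mul_eq_one i j h := by
    have := φ.gain_symm ⟨(i, j), h⟩
    change φ.gain ⟨(j, i), h.symm⟩ = _ at this
    simp [UnitGain.adjMatrix, h, h.symm, this]
  eq_zero i j h := by simp [UnitGain.adjMatrix, h]

theorem isGainMatrix_adjMatrix [DecidableRel G.Adj] : G.IsGainMatrix (G.adjMatrix ℂ) where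
  mul_eq_one i j h := by simp [h, h.symm]
  eq_zero i j h := by simp [h]

/-- An edge is a bridge when it lies on no cycle, and every cycle has the edges of `c`. -/
theorem IsUnicyclic.isBridge (hG : G.IsUnicyclic) {u : V} {c : G.Walk u u} (hc : c.IsCycle)
    {a b : V} (h : G.Adj a b) (hab : s(a, b) ∉ c.edges) : G.IsBridge s(a, b) := by
  rw [isBridge_iff_forall_cycle_notMem (G.mem_edgeSet.2 h)]
  intro v d hd hmem
  have : d.toSubgraph = c.toSubgraph := hG.unique ⟨v, d, hd, rfl⟩ ⟨u, c, hc, rfl⟩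
  rw [← Walk.mem_edges_toSubgraph, this, Walk.mem_edges_toSubgraph] at hmem
  exact hab hmem

theorem Walk.IsCycle.mem_support_iff_mem_dropLast {u : V} {c : G.Walk u u} (hc : c.IsCycle) {v : V} :
    v ∈ c.support.dropLast ↔ v ∈ c.support := by
  refine ⟨List.mem_of_mem_dropLast, fun h => ?_⟩
  rw [← c.tail_support_perm_dropLast_support.mem_iff]
  rcases (Walk.mem_support_iff c).1 h with rfl | h
  · exact Walk.end_mem_tail_support hc.not_nil
  · exact h

variable [DecidableEq V] {u : V}

/-- The cyclic permutation of the vertices along a closed walk. -/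
def Walk.rotation (c : G.Walk u u) : Equiv.Perm V := c.support.dropLast.formPerm

theorem Walk.IsCycle.rotation_getVert {c : G.Walk u u} (hc : c.IsCycle) {i : ℕ}
    (hi : i < c.length) : c.rotation (c.getVert i) = c.getVert (i + 1) := by
  have hlen : c.support.dropLast.length = c.length := by simp
  have hget : ∀ (j : ℕ) (hj : j < c.support.dropLast.length),
      c.support.dropLast[j] = c.getVert j := by
    intro j hj
    rw [List.getElem_dropLast, Walk.support_getElem_eq_getVert]
  have := List.formPerm_apply_getElem _ hc.nodup_dropLast_support i (by omega)
  rw [hget, hget] at this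
  rw [Walk.rotation, this, hlen]
  -- The last step wraps around to index `0`, the base point, which is also `c.getVert c.length`.
  rcases Nat.lt_or_ge (i + 1) c.length with h | h
  · rw [Nat.mod_eq_of_lt h]
  · have h' : i + 1 = c.length := by omega
    rw [h', Nat.mod_self, Walk.getVert_zero, Walk.getVert_length]

theorem Walk.IsCycle.rotation_fst {c : G.Walk u u} (hc : c.IsCycle) {d : G.Dart}
    (hd : d ∈ c.darts) : c.rotation d.fst = d.snd := by
  obtain ⟨i, hi, rfl⟩ := List.mem_iff_getElem.1 hd
  rw [Walk.darts_getElem_eq_getVert]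
  exact hc.rotation_getVert (by simpa using hi)

theorem Walk.IsCycle.support_rotation [Fintype V] {c : G.Walk u u} (hc : c.IsCycle) :
    c.rotation.support = c.support.dropLast.toFinset := by
  refine List.support_formPerm_of_nodup _ hc.nodup_dropLast_support fun x hx => ?_
  have := congrArg List.length hx
  have := hc.three_le_length
  simp at *
  omega

theorem Walk.IsCycle.rotation_ne_self_iff [Finite V] {c : G.Walk u u} (hc : c.IsCycle) {v : V} :
    c.rotation v ≠ v ↔ v ∈ c.support := by
  have := Fintype.ofFinite V
  rw [← Equiv.Perm.mem_support, hc.support_rotation, List.mem_toFinset,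
    hc.mem_support_iff_mem_dropLast]

theorem Walk.IsCycle.isCycle_rotation {c : G.Walk u u} (hc : c.IsCycle) : c.rotation.IsCycle := by
  refine List.isCycle_formPerm hc.nodup_dropLast_support ?_
  have := hc.three_le_length
  simp
  omega

theorem Walk.IsCycle.card_support_rotation [Fintype V] {c : G.Walk u u} (hc : c.IsCycle) :
    c.rotation.support.card = c.length := by
  rw [hc.support_rotation, List.toFinset_card_of_nodup hc.nodup_dropLast_support]
  simp

/-- Otherwise the square of this cyclic permutation would be `1`, while its order is the cycle
length, at least `3`. -/
theorem Walk.IsCycle.rotation_rotation_ne [Finite V] {c : G.Walk u u} (hc : c.IsCycle) {v : V}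
    (hv : c.rotation v ≠ v) : c.rotation (c.rotation v) ≠ v := by
  have := Fintype.ofFinite V
  intro h
  have h1 := hc.isCycle_rotation.orderOf
  rw [hc.card_support_rotation] at h1
  have h2 : c.rotation ^ 2 = 1 := by
    rw [hc.isCycle_rotation.pow_eq_one_iff]
    exact ⟨v, hv, by rwa [pow_two]⟩
  have := Nat.le_of_dvd two_pos (orderOf_dvd_of_pow_eq_one h2)
  have := hc.three_le_length
  omega

theorem Walk.IsCycle.rotation_of_mem_edges {c : G.Walk u u} (hc : c.IsCycle) {a b : V}
    (h : s(a, b) ∈ c.edges) : c.rotation a = b ∨ c.rotation b = a := by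
  rw [Walk.mk_mem_edges_iff_exists] at h
  obtain ⟨i, hi, h⟩ := h
  have := hc.rotation_getVert hi
  grind

theorem UnitGain.prod_adjMatrix_rotation [Fintype V] (φ : G.UnitGain) {c : G.Walk u u}
    (hc : c.IsCycle) :
    ∏ v ∈ c.rotation.support, φ.adjMatrix v (c.rotation v) = (φ.walkGain c : ℂ) := by
  rw [hc.support_rotation, List.prod_toFinset _ hc.nodup_dropLast_support, ← Walk.map_fst_darts,
    List.map_map, UnitGain.walkGain]
  change _ = Circle.coeHom _
  rw [map_list_prod, List.map_map]
  congr 1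
  refine List.map_congr_left fun d hd => ?_
  simp only [Function.comp_apply]
  rw [hc.rotation_fst hd]
  rw [UnitGain.adjMatrix, Matrix.of_apply, dif_pos d.adj]
  rfl

end

end SimpleGraph

open SimpleGraph

theorem mainTheorem5 {V : Type*} [Fintype V] [DecidableEq V] (G : SimpleGraph V)
    [DecidableRel G.Adj] (hG : G.IsUnicyclic) {u : V} (c : G.Walk u u) (hc : c.IsCycle)
    (φ : G.UnitGain) (θ : ℝ) (hθ : φ.walkGain c = Circle.exp θ) :
    φ.adjMatrix.charpoly = (G.adjMatrix ℂ).charpoly +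
      C ((2 * (1 - Real.cos θ) : ℝ) : ℂ) *
        ∑ i ∈ Finset.range ((G.induce {v : V | v ∉ c.support}).matchingNumber + 1),
          (-1) ^ i * ((G.induce {v : V | v ∉ c.support}).matchingCount i : ℂ[X]) *
            X ^ (Fintype.card V - (c.length + 2 * i)) := by
  classical
  have hadj : ∀ v ∈ c.rotation.support, G.Adj v (c.rotation v) := by
    intro v hv
    rw [hc.support_rotation, List.mem_toFinset, ← Walk.map_fst_darts, List.mem_map] at hv
    obtain ⟨d, hd, rfl⟩ := hv
    rw [hc.rotation_fst hd]
    exact d.adj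
  have hs : ∀ v, v ∈ {v : V | v ∉ c.support} ↔ c.rotation v = v := fun v => by
    rw [Set.mem_ofPred_eq, ← hc.rotation_ne_self_iff, Ne, not_not]
  have hcard : Fintype.card {v : V | v ∉ c.support} = Fintype.card V - c.length := by
    rw [← hc.card_support_rotation, ← Finset.card_compl, ← Set.toFinset_card]
    congr 1
    ext v
    rw [Set.mem_toFinset, hs, Finset.mem_compl, Equiv.Perm.notMem_support]
  have key := φ.isGainMatrix_adjMatrix.charpoly_sub_charpoly isGainMatrix_adjMatrix
    hc.isCycle_rotation (fun v => hc.rotation_rotation_ne)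
    (fun a b h hn => hG.isBridge hc h fun he => hn (hc.rotation_of_mem_edges he)) hs
  have h1 : ∏ v ∈ c.rotation.support, φ.adjMatrix v (c.rotation v) =
      Complex.exp (θ * Complex.I) := by
    rw [φ.prod_adjMatrix_rotation hc, hθ, Circle.coe_exp]
  -- Transposed entries read `c` backwards, so this product is inverse to `h1`, edge by edge.
  have h2 : ∏ v ∈ c.rotation.support, φ.adjMatrix (c.rotation v) v =
      Complex.exp (-θ * Complex.I) := by
    rw [neg_mul, Complex.exp_neg, ← h1]
    refine eq_inv_of_mul_eq_one_left ?_
    rw [← Finset.prod_mul_distrib]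
    exact Finset.prod_eq_one fun v hv => φ.isGainMatrix_adjMatrix.mul_eq_one _ _ (hadj v hv).symm
  have h3 : ∏ v ∈ c.rotation.support, G.adjMatrix ℂ v (c.rotation v) = 1 :=
    Finset.prod_eq_one fun v hv => by simp [hadj v hv]
  have h4 : ∏ v ∈ c.rotation.support, G.adjMatrix ℂ (c.rotation v) v = 1 :=
    Finset.prod_eq_one fun v hv => by simp [(hadj v hv).symm]
  have h5 : (1 + 1 - Complex.exp (-θ * Complex.I) - Complex.exp (θ * Complex.I) : ℂ) =
      ((2 * (1 - Real.cos θ) : ℝ) : ℂ) := by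
    push_cast
    rw [Complex.cos]
    ring
  rw [h1, h2, h3, h4, h5, sub_eq_iff_eq_add'] at key
  -- The exponent `n - m - 2i` is never truncated where the count is nonzero: `i` matching edges use
  -- `2i` of the `n - m` vertices off `c`.
  rw [key, hcard]
  simp only [Nat.sub_sub]
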